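/- **Definitions.** An *inductive graded ring* (Igr) $R$ consists of abelian groups $(R_n)_{n\ge 0}$ of exponent $2$ with distinguished elements $\top_n\in R_n$, where $R_0=\{0,\top_0\}$ with $0\ne\top_0$ (so $R_0\cong\mathbb F_2$), of homomorphisms $h_n:R_n\to R_{n+1}$ with $h_n(\top_n)=\top_{n+1}$, and of biadditive products $*:R_n\times R_m\to R_{n+m}$ making $\bigoplus_n R_n$ a commutative ring with unit $\top_0$, such that $h_n(x)=\top_1*x$ for $n\ge1$ and $h_n^p(x)*h_m^q(y)=h_{n+m}^{p+q}(x*y)$ for $p\ge n$, $q\ge m$, where $h_s^t:R_s\to R_t$ denotes the composite of the maps $h_i$. Morphisms are families of additive maps $f_n:R_n\to S_n$ preserving the $\top_n$ and the products. $\mathrm{Igr}_+$ is the full subcategory of those $R$ in which every element of $R_n$, $n\ge 1$, is a sum of products of $n$ elements of $R_1$, and $(\top_1+a)*a=0$ for all $a\in R_1$. $MC(R)$ means that $h_n^m:R_n\to R_m$ has zero kernel for all $n\le m$. A homomorphism $f:A\to B$ of structures (one- or many-sorted) is *pure* if for every positive primitive formula $\varphi(\bar x)=\exists\bar y\,\bigwedge_i\varphi_i(\bar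 x,\bar y)$ (finite conjunction, $\varphi_i$ atomic) and every tuple $\bar a$ in $A$, $B\models\varphi(f(\bar a))$ implies $A\models\varphi(\bar a)$; Igr's are structures for the $\mathbb N$-sorted language with symbols $0_n,\top_n,+_n,h_n,*_{n,m}$. A pure homomorphism is automatically an embedding. **Proposition ($F_*$ preserves pure embeddings).** Let $L$ be a (single-sorted) first-order language and let $\mathcal A$ be a full subcategory of the category of $L$-structures and $L$-homomorphisms that is closed under colimits over non-empty upward directed posets and under powers: if $M\in\mathcal A$ and $J\neq\emptyset$ is a set, then $M^J\in\mathcal A$ (in particular this applies if $\mathcal A$ is closed under directed inductive limits and products). Let $F_*:\mathcal A\to\mathrm{Igr}_+$ be a functor that preserves colimits over non-empty upward directed posets. Let $M,M'\in\mathcal A$ and let $j:M\to M'$ be a pure $L$-embedding. Then: 1. $F_*(j):F_*(M)\to F_*(M')$ is a pure morphism of Igr's; 2. for each $n\in\mathbb N$, $F_n(j):F_n(M)\to F_n(M')$ is a pure morphism of pointed $\mathbb F_2$-modules (in the one-sorted language with $0$, $\top$, $+$), and in particular it is injective; 3. if $MC(F_*(M'))$ holds, then $MC(F_*(M))$ holds.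 -/

import Mathlib

open CategoryTheory CategoryTheory.Limits

universe u

/-! ### First-order structures, powers, purity -/

/-- The category of `L`-structures and `L`-homomorphisms. -/
structure StrCat (L : FirstOrder.Language.{u, u}) : Type (u + 1) where
  /-- The underlying set. -/
  carrier : Type u
  /-- The interpretation of the symbols of `L`. -/
  [str : L.Structure carrier]

attribute [instance] StrCat.str

instance (L : FirstOrder.Language.{u, u}) : Category.{u} (StrCat L) where
  Hom M N := FirstOrder.Language.Hom L M.carrier N.carrier
  id M := FirstOrder.Language.Hom.id L M.carrier
  comp f g := FirstOrder.Language.Hom.comp g f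

/-- The power `M ^ J` of an `L`-structure: functions act and relations hold coordinatewise. -/
def StrCat.power {L : FirstOrder.Language.{u, u}} (M : StrCat L) (J : Type u) : StrCat L where
  carrier := J → M.carrier
  str :=
    { funMap := fun f x i => FirstOrder.Language.Structure.funMap f (fun k => x k i)
      RelMap := fun r x => ∀ i, FirstOrder.Language.Structure.RelMap r (fun k => x k i) }

/-- A homomorphism `f : M → N` of `L`-structures is pure if it reflects every positive primitive
formula `∃ y₁ … yₘ, ⋀ φ ∈ Φ, φ(x₁, …, xₙ, y₁, …, yₘ)`, where `Φ` is a finite list of atomic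
formulas. (Such an `f` is automatically an embedding: take `Φ` to be one atomic formula and
`m = 0`.) -/
def IsPureHom {L : FirstOrder.Language} {M N : Type*} [L.Structure M] [L.Structure N]
    (f : FirstOrder.Language.Hom L M N) : Prop :=
  ∀ (n m : ℕ) (Φ : List (L.Formula (Fin n ⊕ Fin m))),
    (∀ φ ∈ Φ, φ.IsAtomic) →
    ∀ v : Fin n → M,
      (∃ w : Fin m → N, ∀ φ ∈ Φ, φ.Realize (Sum.elim (fun k => f (v k)) w)) →
      ∃ w : Fin m → M, ∀ φ ∈ Φ, φ.Realize (Sum.elim v w)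

/-- Purity of a morphism in the category of `L`-structures. -/
def StrCat.IsPure {L : FirstOrder.Language.{u, u}} {M N : StrCat L} (f : M ⟶ N) : Prop :=
  IsPureHom (L := L) (M := M.carrier) (N := N.carrier) f

/-- The class `A` of `L`-structures is closed under directed inductive limits: whenever a
structure is the colimit, in the category of all `L`-structures, of a diagram of members of `A`
indexed by a (non-empty) upward directed poset, it is a member of `A`. -/
def ClosedUnderDirectedColimits {L : FirstOrder.Language.{u, u}} (A : ObjectProperty (StrCat L)) : Prop :=
  ∀ (I : Type u) [PartialOrder I] [IsDirectedOrder I] [Nonempty I],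
    A.IsClosedUnderColimitsOfShape I

/-- The class `A` of `L`-structures is closed under powers with non-empty exponent. -/
def ClosedUnderPowers {L : FirstOrder.Language.{u, u}} (A : ObjectProperty (StrCat L)) : Prop :=
  ∀ (M : StrCat L) (J : Type u) [Nonempty J], A M → A (M.power J)

/-- The functor `F` preserves directed inductive limits. -/
def PreservesDirectedColimits {C D : Type (u + 1)} [Category.{u} C] [Category.{u} D]
    (F : C ⥤ D) : Prop :=
  ∀ (I : Type u) [PartialOrder I] [IsDirectedOrder I] [Nonempty I], PreservesColimitsOfShape I F

/-! ### Inductive graded rings -/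

/-- The iterate `h_{n+k-1} ∘ ⋯ ∘ h_n : R_n → R_{n+k}`. -/
def iterH {R : ℕ → Type u} [∀ n, AddCommGroup (R n)] (h : ∀ n, R n →+ R (n + 1)) (n : ℕ) :
    ∀ k : ℕ, R n →+ R (n + k)
  | 0 => AddMonoidHom.id (R n)
  | k + 1 => (h (n + k)).comp (iterH h n k)

/-- An inductive graded ring (Igr). Equations between elements whose degrees agree only
propositionally, such as `(n + m) + p` and `n + (m + p)`, are stated in `GradedMonoid R`, the
type of pairs of a degree and an element of that degree. -/
structure Igr : Type (u + 1) where
  /-- The homogeneous component of degree `n`. -/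
  R : ℕ → Type u
  [grp : ∀ n, AddCommGroup (R n)]
  /-- The distinguished element of degree `n`. -/
  top : ∀ n, R n
  /-- The maps `h_n`. -/
  h : ∀ n, R n →+ R (n + 1)
  /-- The biadditive products `R_n × R_m → R_{n+m}`. -/
  mul : ∀ n m, R n →+ R m →+ R (n + m)
  /-- The component of degree `0` is the field with two elements: `0 ≠ 1`. -/
  zero_ne_top : (0 : R 0) ≠ top 0
  /-- The component of degree `0` has no elements besides `0` and `1`. -/
  eq_zero_or_top : ∀ x : R 0, x = 0 ∨ x = top 0
  /-- Every component has exponent two. -/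
  add_self : ∀ n (x : R n), x + x = 0
  h_top : ∀ n, h n (top n) = top (n + 1)
  /-- For `n ≥ 1`, the map `h_n` is the product with `⊤₁`. -/
  h_eq : ∀ n, 1 ≤ n → ∀ x : R n,
    GradedMonoid.mk (n + 1) (h n x) = GradedMonoid.mk (1 + n) (mul 1 n (top 1) x)
  mul_assoc : ∀ n m p (x : R n) (y : R m) (z : R p),
    GradedMonoid.mk (n + m + p) (mul (n + m) p (mul n m x y) z) =
      GradedMonoid.mk (n + (m + p)) (mul n (m + p) x (mul m p y z))
  mul_comm : ∀ n m (x : R n) (y : R m),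
    GradedMonoid.mk (n + m) (mul n m x y) = GradedMonoid.mk (m + n) (mul m n y x)
  /-- The unit is `⊤₀`. -/
  one_mul : ∀ n (x : R n), GradedMonoid.mk (0 + n) (mul 0 n (top 0) x) = GradedMonoid.mk n x
  /-- Compatibility of the products with the transition maps. -/
  h_mul : ∀ n m k l (x : R n) (y : R m),
    GradedMonoid.mk (n + k + (m + l)) (mul (n + k) (m + l) (iterH h n k x) (iterH h m l y)) =
      GradedMonoid.mk (n + m + (k + l)) (iterH h (n + m) (k + l) (mul n m x y))

attribute [instance] Igr.grp

/-- Morphisms of Igr's: pointed additive maps in each degree, compatible with products (and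
with the unit, which is `⊤₀`). Compatibility with the `h_n` is a consequence. -/
@[ext]
structure Igr.Hom (R S : Igr.{u}) : Type u where
  /-- The component in degree `n`. -/
  app : ∀ n, R.R n →+ S.R n
  map_top : ∀ n, app n (R.top n) = S.top n
  map_mul : ∀ n m (x : R.R n) (y : R.R m),
    app (n + m) (R.mul n m x y) = S.mul n m (app n x) (app m y)

instance : Category.{u} Igr.{u} where
  Hom R S := Igr.Hom R S
  id R :=
    { app := fun n => AddMonoidHom.id (R.R n)
      map_top := fun _ => rfl
      map_mul := fun _ _ _ _ => rfl }
  comp f g :=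
    { app := fun n => (g.app n).comp (f.app n)
      map_top := fun n => by simp [f.map_top, g.map_top]
      map_mul := fun n m x y => by simp [f.map_mul, g.map_mul] }

namespace Igr

/-- The product `a₁ * ⋯ * a_{n+1}`, of degree `n + 1`, of `n + 1` elements of degree `1`. -/
def prodOne (R : Igr.{u}) : ∀ n : ℕ, (Fin (n + 1) → R.R 1) → R.R (n + 1)
  | 0, a => a 0
  | n + 1, a => R.mul (n + 1) 1 (R.prodOne n (fun i => a i.castSucc)) (a (Fin.last (n + 1)))

/-- `R` is generated in degree `1`: every element of degree `n ≥ 1` is a sum of products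
`a₁ * ⋯ * aₙ` of elements of degree `1`, that is, the inclusion into `R` of the graded subring
generated by the level `1` is an isomorphism. -/
def GeneratedInDegreeOne (R : Igr.{u}) : Prop :=
  ∀ (n : ℕ) (x : R.R (n + 1)), x ∈ AddSubgroup.closure (Set.range (R.prodOne n))

/-- `R` is hyperbolic: the graded ideal generated by the elements `(⊤₁ + a) * a`, for `a` of
degree `1`, is zero, that is, all of these elements vanish. -/
def IsHyperbolic (R : Igr.{u}) : Prop :=
  ∀ a : R.R 1, R.mul 1 1 (R.top 1 + a) a = 0

/-- The objects of the full subcategory `Igr₊`. -/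
def plus : ObjectProperty Igr.{u} :=
  fun R => R.GeneratedInDegreeOne ∧ R.IsHyperbolic

/-- `MC(R)`: for all `n ≤ m`, the kernel of the transition map `R_n → R_m` is zero. -/
def MC (R : Igr.{u}) : Prop :=
  ∀ (n k : ℕ) (x : R.R n), iterH R.h n k x = 0 → x = 0

/-! ### The polysorted language of Igr's -/

/-- Terms of the first-order language of Igr's. The sorts are the natural numbers, the index of
the family is the sort of the term, and `sort` gives the sort of each variable. -/
inductive Term {V : Type} (sort : V → ℕ) : ℕ → Type
  | var (v : V) : Term sort (sort v)
  | zero (n : ℕ) : Term sort n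
  | top (n : ℕ) : Term sort n
  | add {n : ℕ} (s t : Term sort n) : Term sort n
  | h {n : ℕ} (t : Term sort n) : Term sort (n + 1)
  | mul {n m : ℕ} (s : Term sort n) (t : Term sort m) : Term sort (n + m)

/-- The value of a term in an Igr at an assignment of the variables. -/
def Term.eval {V : Type} {sort : V → ℕ} (R : Igr.{u}) (v : ∀ x, R.R (sort x)) :
    ∀ {n : ℕ}, Term sort n → R.R n
  | _, .var x => v x
  | _, .zero _ => 0
  | _, .top n => R.top n
  | _, .add s t => s.eval R v + t.eval R v
  | _, .h t => R.h _ (t.eval R v)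
  | _, .mul s t => R.mul _ _ (s.eval R v) (t.eval R v)

/-- An atomic formula of the language of Igr's (which has no relation symbols besides
equality): an equation between two terms of the same sort. -/
structure Atomic {V : Type} (sort : V → ℕ) : Type where
  /-- The common sort of the two sides. -/
  deg : ℕ
  /-- The left-hand side. -/
  lhs : Term sort deg
  /-- The right-hand side. -/
  rhs : Term sort deg

/-- Truth of an atomic formula in an Igr at an assignment of the variables. -/
def Atomic.Holds {V : Type} {sort : V → ℕ} (e : Atomic sort) (R : Igr.{u})
    (v : ∀ x, R.R (sort x)) : Prop :=
  e.lhs.eval R v = e.rhs.eval R v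

/-- The joint assignment of two families of sorted variables. -/
def assign (R : Igr.{u}) {n m : ℕ} {σ : Fin n → ℕ} {τ : Fin m → ℕ}
    (v : ∀ k, R.R (σ k)) (w : ∀ k, R.R (τ k)) : ∀ x : Fin n ⊕ Fin m, R.R (Sum.elim σ τ x)
  | .inl k => v k
  | .inr k => w k

/-- An Igr-morphism `f : R → S` is pure if it reflects every positive primitive formula
`∃ y₁ … yₘ, ⋀ e ∈ E, e(x₁, …, xₙ, y₁, …, yₘ)` of the polysorted language of Igr's, where `σ` and
`τ` are the sorts of the variables and `E` is a finite list of atomic formulas. -/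
def IsPure {R S : Igr.{u}} (f : R ⟶ S) : Prop :=
  ∀ (n m : ℕ) (σ : Fin n → ℕ) (τ : Fin m → ℕ) (E : List (Atomic (Sum.elim σ τ)))
    (v : ∀ k, R.R (σ k)),
      (∃ w : ∀ k, S.R (τ k), ∀ e ∈ E, e.Holds S (S.assign (fun k => f.app (σ k) (v k)) w)) →
      ∃ w : ∀ k, R.R (τ k), ∀ e ∈ E, e.Holds R (R.assign v w)

end Igr

/-! ### Pointed modules over the field with two elements -/

/-- Function symbols for pointed `𝔽₂`-modules (the scalars `0` and `1` need no symbols). -/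
inductive PointedFunc : ℕ → Type
  | zero : PointedFunc 0
  | top : PointedFunc 0
  | add : PointedFunc 2

/-- The single-sorted language of pointed `𝔽₂`-modules. -/
def pointedLang : FirstOrder.Language.{0, 0} := ⟨PointedFunc, fun _ => Empty⟩

namespace Igr

/-- The component of degree `n` of an Igr as a pointed `𝔽₂`-module. -/
instance pointedStr (R : Igr.{u}) (n : ℕ) : pointedLang.Structure (R.R n) where
  funMap := fun {_} f => match f with
    | PointedFunc.zero => fun _ => 0
    | PointedFunc.top => fun _ => R.top n
    | PointedFunc.add => fun x => x 0 + x 1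
  RelMap := fun r => r.elim

/-- The component of degree `n` of an Igr-morphism as a morphism of pointed `𝔽₂`-modules. -/
def pointedHom {R S : Igr.{u}} (f : R ⟶ S) (n : ℕ) :
    FirstOrder.Language.Hom pointedLang (R.R n) (S.R n) where
  toFun := f.app n
  map_fun' := by
    intro k g x
    change PointedFunc k at g
    cases g with
    | zero => exact map_zero (f.app n)
    | top => exact f.map_top n
    | add => exact map_add (f.app n) (x 0) (x 1)
  map_rel' := fun r => r.elim

end Igr

/-! Purity of `j : M ⟶ M'` says that any finite set `D` of atomic facts, true in `M'` about elements
of `M` and `M'`, is realized in `M` by some map `g D : M' → M`, the elements of `M` being kept fixed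
(`IsPureHom.exists_realize`). Along the directed poset of all such `D`, each fact eventually holds,
so the maps `g D` assemble into a homomorphism from `M'` to the reduced power of `M` modulo tails
whose composite with `j` is the diagonal (`IsPure.exists_reducedPower`).

This reduced power is the directed colimit of the powers of `M` by the tails
(`reducedPowerIsColimit`), so it lies in `A` and `F` preserves the colimit. Directed limits of Igr's
are computed degreewise, so a positive primitive formula true in the limit is true at some stage
(`exists_solvable_of_directLimit`). A formula true in `F M'` at the image of `v` is therefore true
in `F` of a single power of `M`, at the image of `v` under the diagonal; a coordinate projection
brings it back to `v` in `F M`. `F` need not preserve powers: only functoriality on "diagonal, then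
projection, is the identity" is used. -/

/-! ### Positive diagrams of pure homomorphisms -/

namespace IsPureHom

open FirstOrder FirstOrder.Language

variable {L : FirstOrder.Language} {M N : Type*} [L.Structure M] [L.Structure N]

theorem _root_.FirstOrder.Language.BoundedFormula.IsAtomic.restrictFreeVar
    {α β : Type*} [DecidableEq α] {n : ℕ} {φ : L.BoundedFormula α n} (hφ : φ.IsAtomic)
    (f : φ.freeVarFinset → β) : (φ.restrictFreeVar f).IsAtomic := by
  cases hφ with
  | equal t₁ t₂ => exact .equal _ _
  | rel R ts => exact .rel R _

/-- Purity applied to `∃ y` with empty matrix. -/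
theorem nonempty_domain {f : L.Hom M N} (hf : IsPureHom f) [Nonempty N] : Nonempty M := by
  obtain ⟨w, -⟩ := hf 0 1 [] (by simp) Fin.elim0 ⟨fun _ => Classical.arbitrary N, by simp⟩
  exact ⟨w 0⟩

open Classical in
/-- Finitely many atomic facts about the elements of `M` and `N` that hold in `N` along a pure
homomorphism `M → N` hold in `M` along some map `N → M`. -/
theorem exists_realize {f : L.Hom M N} (hf : IsPureHom f) (D : Finset (L.Formula (M ⊕ N)))
    (hat : ∀ φ ∈ D, φ.IsAtomic) (hD : ∀ φ ∈ D, φ.Realize (Sum.elim f id)) :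
    ∃ g : N → M, ∀ φ ∈ D, φ.Realize (Sum.elim id g) := by
  -- Only finitely many elements occur in `D`: those of `M` become the parameters of a positive
  -- primitive formula, those of `N` its quantified variables.
  let S : Finset (M ⊕ N) := D.biUnion fun φ => φ.freeVarFinset
  let e₁ := S.toLeft.equivFin
  let e₂ := S.toRight.equivFin
  have hl : ∀ φ ∈ D, ∀ a, Sum.inl a ∈ φ.freeVarFinset → a ∈ S.toLeft := fun φ hφ a ha =>
    Finset.mem_toLeft.2 (Finset.mem_biUnion.2 ⟨_, hφ, ha⟩)
  have hr : ∀ φ ∈ D, ∀ b, Sum.inr b ∈ φ.freeVarFinset → b ∈ S.toRight := fun φ hφ b hb =>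
    Finset.mem_toRight.2 (Finset.mem_biUnion.2 ⟨_, hφ, hb⟩)
  let ρ : ∀ φ ∈ D, φ.freeVarFinset → Fin S.toLeft.card ⊕ Fin S.toRight.card := fun φ hφ x =>
    match x with
    | ⟨.inl a, ha⟩ => .inl (e₁ ⟨a, hl φ hφ a ha⟩)
    | ⟨.inr b, hb⟩ => .inr (e₂ ⟨b, hr φ hφ b hb⟩)
  obtain ⟨w, hw⟩ := hf S.toLeft.card S.toRight.card
    (D.attach.toList.map fun φ => φ.1.restrictFreeVar (ρ φ.1 φ.2))
    (by
      simp only [List.mem_map, Finset.mem_toList, Finset.mem_attach, true_and]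
      rintro _ ⟨φ, rfl⟩
      exact (hat φ.1 φ.2).restrictFreeVar _)
    (fun k => (e₁.symm k).1)
    ⟨fun k => (e₂.symm k).1, by
      simp only [List.mem_map, Finset.mem_toList, Finset.mem_attach, true_and]
      rintro _ ⟨φ, rfl⟩
      refine (BoundedFormula.realize_restrictFreeVar (Sum.elim f id) ?_).2 (hD φ.1 φ.2)
      rintro ⟨a | b, h⟩ <;> simp [ρ]⟩
  have hne : N → Nonempty M := fun b => haveI : Nonempty N := ⟨b⟩; hf.nonempty_domain
  -- Elements of `N` not mentioned in `D` may go anywhere.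
  refine ⟨fun b => if hb : b ∈ S.toRight then w (e₂ ⟨b, hb⟩) else (hne b).some, fun φ hφ => ?_⟩
  refine (BoundedFormula.realize_restrictFreeVar (f := ρ φ hφ) _ ?_).1
    (hw _ (List.mem_map.2 ⟨⟨φ, hφ⟩, by simp, rfl⟩))
  rintro ⟨a | b, h⟩
  · simp [ρ]
  · change w (e₂ ⟨b, hr φ hφ b h⟩) = dite _ _ _
    rw [dif_pos (hr φ hφ b h)]

/-- The atomic facts about the elements of `M` and `N` that hold in `N` along `f : M → N`. -/
abbrev Fact (f : L.Hom M N) : Type _ :=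
  {φ : L.Formula (M ⊕ N) // φ.IsAtomic ∧ φ.Realize (Sum.elim f id)}

theorem exists_realize_fact {f : L.Hom M N} (hf : IsPureHom f) (D : Finset (Fact f)) :
    ∃ g : N → M, ∀ φ ∈ D, φ.1.Realize (Sum.elim id g) := by
  classical
  obtain ⟨g, hg⟩ := hf.exists_realize (D.image Subtype.val)
    (by simp only [Finset.mem_image]; rintro _ ⟨φ, -, rfl⟩; exact φ.2.1)
    (by simp only [Finset.mem_image]; rintro _ ⟨φ, -, rfl⟩; exact φ.2.2)
  exact ⟨g, fun φ hφ => hg _ (Finset.mem_image_of_mem _ hφ)⟩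

end IsPureHom

/-! ### Reduced powers modulo a filter of tails -/

namespace StrCat

variable {L : FirstOrder.Language.{u, u}}

open FirstOrder.Language Filter

theorem hom_map_fun {M N : StrCat L} (f : M ⟶ N) {n : ℕ} (s : L.Functions n)
    (x : Fin n → M.carrier) :
    f.toFun (Structure.funMap s x) = Structure.funMap s (fun k => f.toFun (x k)) :=
  f.map_fun' s x

theorem hom_map_rel {M N : StrCat L} (f : M ⟶ N) {n : ℕ} (r : L.Relations n)
    (x : Fin n → M.carrier) (h : Structure.RelMap r x) :
    Structure.RelMap r (fun k => f.toFun (x k)) :=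
  f.map_rel' r x h

@[ext]
theorem hom_ext {M N : StrCat L} {f g : M ⟶ N} (h : ∀ x, f.toFun x = g.toFun x) : f = g :=
  FirstOrder.Language.Hom.ext h

/-- The diagonal `M → M ^ J`. -/
def diag (M : StrCat L) (J : Type u) : M ⟶ M.power J where
  toFun x _ := x
  map_fun' _ _ := rfl
  map_rel' _ _ h _ := h

/-- Reindexing `M ^ J → M ^ K` along a map `K → J`. -/
def powerMap (M : StrCat L) {J K : Type u} (e : K → J) : M.power J ⟶ M.power K where
  toFun x k := x (e k)
  map_fun' _ _ := rfl
  map_rel' _ _ h k := h (e k)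

/-- The projection of `M ^ J` to a coordinate. -/
def proj (M : StrCat L) {J : Type u} (i : J) : M.power J ⟶ M where
  toFun x := x i
  map_fun' _ _ := rfl
  map_rel' _ _ h := h i

variable (M : StrCat L) (I : Type u) [PartialOrder I]

/-- The reduced power of `M` modulo the filter generated by the tails `{i | d ≤ i}` of `I`. -/
noncomputable def reducedPower : StrCat L where
  carrier := Germ (atTop : Filter I) M.carrier
  str :=
    -- Chosen representatives are used here; `funMap_toGerm` and `relMap_toGerm` show that the
    -- choice is immaterial.
    { funMap := fun s x => ((fun i => Structure.funMap s fun k => (x k).out i : I → M.carrier) :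
        Germ (atTop : Filter I) M.carrier)
      RelMap := fun r x => ∀ᶠ i in (atTop : Filter I), Structure.RelMap r fun k => (x k).out i }

variable {I}

/-- The class in the reduced power of a family of elements of `M`. -/
def toGerm (x : I → M.carrier) : (M.reducedPower I).carrier := (x : Germ (atTop : Filter I) _)

theorem toGerm_surjective : Function.Surjective (M.toGerm (I := I)) := Quotient.exists_rep

variable {M}

theorem toGerm_eq_iff {x y : I → M.carrier} : M.toGerm x = M.toGerm y ↔ x =ᶠ[atTop] y :=
  Germ.coe_eq

/-- Arities are finite, so finitely many eventual agreements hold simultaneously. -/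
theorem eventually_out_toGerm {n : ℕ} (x : Fin n → I → M.carrier) :
    ∀ᶠ i in (atTop : Filter I), ∀ k, Quotient.out (M.toGerm (x k)) i = x k i :=
  eventually_all.2 fun k => Quotient.mk_out (s := germSetoid atTop M.carrier) (x k)

theorem funMap_toGerm {n : ℕ} (s : L.Functions n) (x : Fin n → I → M.carrier) :
    Structure.funMap s (fun k => M.toGerm (x k)) =
      M.toGerm fun i => Structure.funMap s fun k => x k i := by
  refine toGerm_eq_iff.2 ?_
  filter_upwards [eventually_out_toGerm x] with i hi
  simp only [hi]

theorem relMap_toGerm {n : ℕ} (r : L.Relations n) (x : Fin n → I → M.carrier) :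
    Structure.RelMap r (fun k => M.toGerm (x k)) ↔
      ∀ᶠ i in (atTop : Filter I), Structure.RelMap r fun k => x k i := by
  refine eventually_congr ?_
  filter_upwards [eventually_out_toGerm x] with i hi
  simp only [hi]

/-! ### The reduced power as a directed colimit of powers -/

variable (M I)

/-- The directed system of the powers of `M` by the tails of `I`. -/
def tailPower : I ⥤ StrCat L where
  obj d := M.power (Set.Ici d)
  map {d d'} h := M.powerMap fun i => ⟨i.1, (leOfHom h).trans i.2⟩

variable {M I}

open Classical in
/-- The extension of a family defined on a tail of `I` by a constant. -/
noncomputable def extendTail {d : I} (x : Set.Ici d → M.carrier) (i : I) : M.carrier :=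
  if h : d ≤ i then x ⟨i, h⟩ else x ⟨d, le_refl d⟩

theorem extendTail_of_le {d : I} (x : Set.Ici d → M.carrier) {i : I} (h : d ≤ i) :
    extendTail x i = x ⟨i, h⟩ := dif_pos h

variable (M I)

/-- The natural map from the power by a tail to the reduced power. -/
noncomputable def tailPowerι (d : I) : (M.tailPower I).obj d ⟶ M.reducedPower I where
  toFun x := M.toGerm (extendTail x)
  map_fun' s x := by
    refine Eq.trans ?_ (funMap_toGerm s (fun k => extendTail (x k))).symm
    refine toGerm_eq_iff.2 ?_
    filter_upwards [eventually_ge_atTop d] with i hi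
    exact (extendTail_of_le (M := M) _ hi).trans
      (congrArg (Structure.funMap s) (funext fun k => (extendTail_of_le (M := M) (x k) hi).symm))
  map_rel' r x h := by
    refine (relMap_toGerm r (fun k => extendTail (x k))).2 ?_
    filter_upwards [eventually_ge_atTop d] with i hi
    exact (congrArg (Structure.RelMap r)
      (funext fun k => extendTail_of_le (M := M) (x k) hi)).mpr (h ⟨i, hi⟩)

/-- The cocone of the powers of `M` by the tails of `I` over the reduced power. -/
noncomputable def reducedPowerCocone : Cocone (M.tailPower I) where
  pt := M.reducedPower I
  ι :=
    { app := M.tailPowerι I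
      naturality := fun d d' h => by
        ext x
        refine toGerm_eq_iff.2 ?_
        filter_upwards [eventually_ge_atTop d'] with i hi
        exact (extendTail_of_le (M := M) _ hi).trans
          (extendTail_of_le (M := M) x ((leOfHom h).trans hi)).symm }

variable {M I} in
theorem cocone_app_tail (c : Cocone (M.tailPower I)) {d e : I} (h : d ≤ e) (x : I → M.carrier) :
    (c.ι.app d).toFun (fun i => x i.1) = (c.ι.app e).toFun (fun i => x i.1) := by
  rw [← c.w (homOfLE h)]
  rfl

variable [OrderBot I] [IsDirectedOrder I]

variable {M I} in
theorem cocone_app_tail_congr (c : Cocone (M.tailPower I)) {x y : I → M.carrier}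
    (h : x =ᶠ[atTop] y) :
    (c.ι.app ⊥).toFun (fun i => x i.1) = (c.ι.app ⊥).toFun (fun i => y i.1) := by
  obtain ⟨e, he⟩ := eventually_atTop.1 h
  rw [cocone_app_tail c (bot_le : ⊥ ≤ e), cocone_app_tail c (bot_le : ⊥ ≤ e)]
  congr 1
  funext i
  exact he i.1 i.2

variable {M I} in
/-- The map from the reduced power induced by a cocone over the powers by the tails. -/
noncomputable def reducedPowerDesc (c : Cocone (M.tailPower I)) : M.reducedPower I ⟶ c.pt where
  -- `Set.Ici ⊥` is all of `I`, so the component at `⊥` accepts every family; representatives do not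
  -- matter by `cocone_app_tail_congr`.
  toFun z := (c.ι.app ⊥).toFun (fun i => Quotient.out z i.1)
  map_fun' s x := by
    refine (cocone_app_tail_congr c (Quotient.mk_out (s := germSetoid atTop M.carrier) _)).trans ?_
    exact hom_map_fun (c.ι.app ⊥) s (fun k i => Quotient.out (x k) i.1)
  map_rel' r x h := by
    obtain ⟨e, he⟩ := eventually_atTop.1 h
    -- The relation is known only on the tail from `e`, so the component at `e` must replace the one
    -- at `⊥`.
    simp only [cocone_app_tail c (bot_le : ⊥ ≤ e)]
    exact hom_map_rel (c.ι.app e) r (fun k i => Quotient.out (x k) i.1) fun i => he i.1 i.2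

variable {M I} in
theorem reducedPowerDesc_toGerm (c : Cocone (M.tailPower I)) (x : I → M.carrier) :
    (reducedPowerDesc c).toFun (M.toGerm x) = (c.ι.app ⊥).toFun (fun i => x i.1) :=
  cocone_app_tail_congr c (Quotient.mk_out (s := germSetoid atTop M.carrier) x)

/-- The reduced power is the colimit of the powers by the tails. -/
noncomputable def reducedPowerIsColimit : IsColimit (M.reducedPowerCocone I) where
  desc := reducedPowerDesc
  fac c d := by
    ext x
    refine (reducedPowerDesc_toGerm c _).trans ?_
    rw [cocone_app_tail c (bot_le : ⊥ ≤ d)]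
    refine congrArg (c.ι.app d).toFun (funext fun i => ?_)
    exact extendTail_of_le (M := M) x i.2
  uniq c m hm := by
    ext z
    obtain ⟨x, rfl⟩ := M.toGerm_surjective z
    rw [reducedPowerDesc_toGerm, ← hm (⊥ : I)]
    refine congrArg (fun y => m.toFun (M.toGerm y)) (funext fun i => ?_)
    exact (extendTail_of_le (M := M) (d := (⊥ : I)) (fun i => x i.1) bot_le).symm

/-- A pure homomorphism `M → N` factors the diagonal of some reduced power of `M`. -/
theorem IsPure.exists_reducedPower {M N : StrCat L} {j : M ⟶ N} (hj : IsPure j) :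
    ∃ (I : Type u) (_ : PartialOrder I) (_ : OrderBot I) (_ : IsDirectedOrder I)
      (g : N ⟶ M.reducedPower I),
      (j ≫ g : M ⟶ M.reducedPower I) = M.diag (Set.Ici (⊥ : I)) ≫ M.tailPowerι I (⊥ : I) := by
  classical
  choose g hg using hj.exists_realize_fact
  -- `g D` respects `φ` as soon as `D` contains `φ`.
  have key : ∀ φ : IsPureHom.Fact j,
      ∀ᶠ D in (atTop : Filter (Finset (IsPureHom.Fact j))), φ.1.Realize (Sum.elim id (g D)) :=
    fun φ => (eventually_ge_atTop {φ}).mono fun D hD => hg D φ (Finset.singleton_subset_iff.1 hD)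
  refine ⟨Finset (IsPureHom.Fact j), inferInstance, inferInstance, inferInstance,
    { toFun := fun y => M.toGerm fun D => g D y
      map_fun' := fun {n} s x => ?_
      map_rel' := fun {n} r x h => ?_ }, ?_⟩
  · refine Eq.trans ?_ (funMap_toGerm s (fun k D => g D (x k))).symm
    refine toGerm_eq_iff.2 ?_
    have := key ⟨Term.equal (Term.var (Sum.inr (Structure.funMap s x)))
      (Term.func s fun k => Term.var (Sum.inr (x k))), .equal _ _, by simp [Formula.realize_equal]⟩
    filter_upwards [this] with D hD
    simpa [Formula.realize_equal] using hD
  · refine (relMap_toGerm r (fun k D => g D (x k))).2 ?_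
    have := key ⟨r.formula fun k => Term.var (Sum.inr (x k)), .rel _ _,
      by simpa [Formula.realize_rel] using h⟩
    filter_upwards [this] with D hD
    simpa [Formula.realize_rel] using hD
  · ext a
    refine toGerm_eq_iff.2 ?_
    -- The fact `a = j a` forces `g D (j a) = a` eventually.
    have := key ⟨Term.equal (Term.var (Sum.inl a)) (Term.var (Sum.inr (j.toFun a))), .equal _ _, by
      simp only [Formula.realize_equal]; rfl⟩
    filter_upwards [this] with D hD
    refine Eq.trans ?_ (extendTail_of_le (M := M) _ bot_le).symm
    simp only [Formula.realize_equal, Term.realize_var, Sum.elim_inl, Sum.elim_inr, id] at hD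
    exact hD.symm

end StrCat

namespace Igr

/-! ### Elementary facts about morphisms -/

/-- In positive degree `h` is multiplication by `⊤₁`, which `f` preserves; in degree `0` there are
only `0` and `⊤₀` to check. -/
theorem Hom.map_h {R S : Igr.{u}} (f : R ⟶ S) (n : ℕ) (x : R.R n) :
    f.app (n + 1) (R.h n x) = S.h n (f.app n x) := by
  obtain rfl | hn := Nat.eq_zero_or_pos n
  · obtain rfl | rfl := R.eq_zero_or_top x
    · simp only [map_zero]
    · rw [R.h_top, f.map_top, f.map_top, S.h_top]
  · have key : GradedMonoid.mk (n + 1) (f.app (n + 1) (R.h n x)) =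
        GradedMonoid.mk (1 + n) (f.app (1 + n) (R.mul 1 n (R.top 1) x)) :=
      congrArg (fun p : GradedMonoid R.R => GradedMonoid.mk p.1 (f.app p.1 p.2)) (R.h_eq n hn x)
    rw [f.map_mul, f.map_top, ← S.h_eq n hn] at key
    exact eq_of_heq (Sigma.mk.inj key).2

theorem Hom.map_iterH {R S : Igr.{u}} (f : R ⟶ S) (n k : ℕ) (x : R.R n) :
    f.app (n + k) (iterH R.h n k x) = iterH S.h n k (f.app n x) := by
  induction k with
  | zero => rfl
  | succ k ih => exact (f.map_h _ _).trans (congrArg (S.h (n + k)) ih)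

theorem Hom.map_prodOne {R S : Igr.{u}} (f : R ⟶ S) (n : ℕ) (a : Fin (n + 1) → R.R 1) :
    f.app (n + 1) (R.prodOne n a) = S.prodOne n (fun i => f.app 1 (a i)) := by
  induction n with
  | zero => rfl
  | succ n ih =>
    refine (f.map_mul _ _ _ _).trans ?_
    rw [ih]
    rfl

theorem Hom.map_eval {R S : Igr.{u}} (f : R ⟶ S) {V : Type} {sort : V → ℕ}
    (v : ∀ x, R.R (sort x)) {n : ℕ} (t : Term sort n) :
    f.app n (t.eval R v) = t.eval S (fun x => f.app _ (v x)) := by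
  induction t with
  | var x => rfl
  | zero n => exact map_zero _
  | top n => exact f.map_top n
  | add s t hs ht => exact (map_add _ _ _).trans (congrArg₂ _ hs ht)
  | h t ht => exact (f.map_h _ _).trans (congrArg _ ht)
  | mul s t hs ht => exact (f.map_mul _ _ _ _).trans (by rw [hs, ht]; rfl)

theorem Atomic.Holds.map {R S : Igr.{u}} (f : R ⟶ S) {V : Type} {sort : V → ℕ}
    {e : Atomic sort} {v : ∀ x, R.R (sort x)} (h : e.Holds R v) :
    e.Holds S (fun x => f.app _ (v x)) :=
  (f.map_eval v e.lhs).symm.trans ((congrArg _ h).trans (f.map_eval v e.rhs))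

theorem Hom.map_assign {R S : Igr.{u}} (f : R ⟶ S) {n m : ℕ} {σ : Fin n → ℕ} {τ : Fin m → ℕ}
    (v : ∀ k, R.R (σ k)) (w : ∀ k, R.R (τ k)) :
    (fun x => f.app _ (R.assign v w x)) =
      S.assign (fun k => f.app _ (v k)) (fun k => f.app _ (w k)) := by
  funext x
  cases x <;> rfl

/-- Truth in `R`, at parameters `v`, of the positive primitive formula with matrix `E`. -/
def Solvable (R : Igr.{u}) {n m : ℕ} {σ : Fin n → ℕ} {τ : Fin m → ℕ}
    (E : List (Atomic (Sum.elim σ τ))) (v : ∀ k, R.R (σ k)) : Prop :=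
  ∃ w : ∀ k, R.R (τ k), ∀ e ∈ E, e.Holds R (R.assign v w)

theorem Solvable.map {R S : Igr.{u}} (f : R ⟶ S) {n m : ℕ} {σ : Fin n → ℕ} {τ : Fin m → ℕ}
    {E : List (Atomic (Sum.elim σ τ))} {v : ∀ k, R.R (σ k)} (h : R.Solvable E v) :
    S.Solvable E (fun k => f.app _ (v k)) := by
  obtain ⟨w, hw⟩ := h
  refine ⟨fun k => f.app _ (w k), fun e he => ?_⟩
  rw [← f.map_assign]
  exact (hw e he).map f

/-! ### Directed colimits -/

section DirectLimit

variable {I : Type u} [PartialOrder I] (K : I ⥤ Igr.{u})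

/-- The transition maps in degree `n` of a diagram of Igr's. -/
def trans (n : ℕ) (i j : I) (hij : i ≤ j) : (K.obj i).R n →+ (K.obj j).R n :=
  (K.map (homOfLE hij)).app n

theorem trans_id (n : ℕ) {i : I} (x : (K.obj i).R n) : trans K n i i le_rfl x = x :=
  congrArg (fun f : K.obj i ⟶ K.obj i => f.app n x) (K.map_id i)

theorem trans_trans (n : ℕ) {i j k : I} (hij : i ≤ j) (hjk : j ≤ k) (x : (K.obj i).R n) :
    trans K n j k hjk (trans K n i j hij x) = trans K n i k (hij.trans hjk) x :=
  (congrArg (fun f : K.obj i ⟶ K.obj k => f.app n x)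
    (K.map_comp (homOfLE hij) (homOfLE hjk))).symm

instance (n : ℕ) : DirectedSystem (fun i => (K.obj i).R n) (trans K n · · ·) where
  map_self _ x := trans_id K n x
  map_map _ _ _ hij hjk x := trans_trans K n hij hjk x

variable [IsDirectedOrder I] [Nonempty I]

/-- The component of degree `n` of the direct limit. -/
abbrev Lim (n : ℕ) : Type u := DirectLimit (fun i => (K.obj i).R n) (trans K n)

/-- The natural map from a stage to the direct limit. -/
noncomputable def toLim (i : I) (n : ℕ) : (K.obj i).R n →+ Lim K n where
  toFun x := Quotient.mk (DirectLimit.setoid (trans K n)) ⟨i, x⟩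
  map_zero' := (DirectLimit.zero_def (f := trans K n) i).symm
  map_add' x y := (DirectLimit.add_def (f := trans K n) i x y).symm

variable {K}

theorem toLim_trans (n : ℕ) {i j : I} (hij : i ≤ j) (x : (K.obj i).R n) :
    toLim K j n (trans K n i j hij x) = toLim K i n x :=
  DirectLimit.mk_apply (F := fun i => (K.obj i).R n) (f := trans K n) i j x hij

theorem toLim_eq_iff {n : ℕ} {i : I} {x y : (K.obj i).R n} :
    toLim K i n x = toLim K i n y ↔ ∃ j, ∃ hij : i ≤ j, trans K n i j hij x = trans K n i j hij y :=
  (Quotient.eq (r := DirectLimit.setoid (trans K n))).trans ⟨fun ⟨j, h, _, e⟩ => ⟨j, h, e⟩, fun ⟨j, h, e⟩ => ⟨j, h, h, e⟩⟩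

theorem exists_toLim {n : ℕ} (x : Lim K n) : ∃ i, ∃ y, toLim K i n y = x := by
  obtain ⟨i, y, rfl⟩ := DirectLimit.exists_eq_mk _ x
  exact ⟨i, y, rfl⟩

/-- Elements of the direct limit come from a common late stage. -/
theorem exists_toLim_ge {n : ℕ} (x : Lim K n) (i : I) :
    ∃ j, i ≤ j ∧ ∃ y, toLim K j n y = x := by
  obtain ⟨k, y, rfl⟩ := exists_toLim x
  obtain ⟨j, hij, hkj⟩ := exists_ge_ge i k
  exact ⟨j, hij, trans K n k j hkj y, toLim_trans n hkj y⟩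

theorem exists_toLim₂ {n m : ℕ} (x : Lim K n) (y : Lim K m) :
    ∃ i x' y', toLim K i n x' = x ∧ toLim K i m y' = y := by
  obtain ⟨i, x, rfl⟩ := exists_toLim x
  obtain ⟨j, hij, y, rfl⟩ := exists_toLim_ge y i
  exact ⟨j, trans K n i j hij x, y, toLim_trans n hij x, rfl⟩

theorem exists_toLim₃ {n m p : ℕ} (x : Lim K n) (y : Lim K m) (z : Lim K p) :
    ∃ i x' y' z', toLim K i n x' = x ∧ toLim K i m y' = y ∧ toLim K i p z' = z := by
  obtain ⟨i, x, y, rfl, rfl⟩ := exists_toLim₂ x y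
  obtain ⟨j, hij, z, rfl⟩ := exists_toLim_ge z i
  exact ⟨j, trans K n i j hij x, trans K m i j hij y, z, toLim_trans n hij x,
    toLim_trans m hij y, rfl⟩

/-- Transfers the ring identities between propositionally equal degrees from a stage to the limit,
without casts. -/
theorem mk_toLim {i : I} {n m : ℕ} {x : (K.obj i).R n} {y : (K.obj i).R m}
    (h : GradedMonoid.mk n x = GradedMonoid.mk m y) :
    GradedMonoid.mk (A := Lim K) n (toLim K i n x) = GradedMonoid.mk m (toLim K i m y) :=
  congrArg (fun p : GradedMonoid (K.obj i).R =>
    GradedMonoid.mk (A := Lim K) p.1 (toLim K i p.1 p.2)) h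

variable (K)

/-- The products of the direct limit, as functions. -/
noncomputable def limMulFun (n m : ℕ) : Lim K n → Lim K m → Lim K (n + m) :=
  DirectLimit.map₂ (trans K n) (trans K m) (trans K (n + m))
    (fun i x y => (K.obj i).mul n m x y)
    fun _ _ h x y => (K.map (homOfLE h)).map_mul n m x y

theorem limMulFun_toLim {n m : ℕ} (i : I) (x : (K.obj i).R n) (y : (K.obj i).R m) :
    limMulFun K n m (toLim K i n x) (toLim K i m y) = toLim K i (n + m) ((K.obj i).mul n m x y) :=
  DirectLimit.map₂_def (trans K n) (trans K m) (trans K (n + m)) _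
    (fun _ _ h x y => (K.map (homOfLE h)).map_mul n m x y) i x y

/-- The products of the direct limit. -/
noncomputable def limMul (n m : ℕ) : Lim K n →+ Lim K m →+ Lim K (n + m) :=
  AddMonoidHom.mk' (fun x => AddMonoidHom.mk' (limMulFun K n m x) fun y z => by
    obtain ⟨i, x, y, z, rfl, rfl, rfl⟩ := exists_toLim₃ x y z
    simp only [← map_add, limMulFun_toLim]) fun x y => by
    ext z
    obtain ⟨i, x, y, z, rfl, rfl, rfl⟩ := exists_toLim₃ x y z
    simp only [AddMonoidHom.mk'_apply, AddMonoidHom.add_apply, ← map_add, limMulFun_toLim]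
    rw [map_add ((K.obj i).mul n m) x y, AddMonoidHom.add_apply]

theorem limMul_toLim {n m : ℕ} (i : I) (x : (K.obj i).R n) (y : (K.obj i).R m) :
    limMul K n m (toLim K i n x) (toLim K i m y) = toLim K i (n + m) ((K.obj i).mul n m x y) :=
  limMulFun_toLim K i x y

/-- The transition maps between the degrees of the direct limit. -/
noncomputable def limH (n : ℕ) : Lim K n →+ Lim K (n + 1) :=
  AddMonoidHom.mk' (DirectLimit.map (trans K n) (trans K (n + 1)) (fun i => (K.obj i).h n)
    fun _ _ h x => (K.map (homOfLE h)).map_h n x) fun x y => by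
    obtain ⟨i, x, y, rfl, rfl⟩ := exists_toLim₂ x y
    rw [← map_add]
    exact (congrArg (toLim K i (n + 1)) (map_add ((K.obj i).h n) x y)).trans (map_add _ _ _)

theorem limH_toLim {n : ℕ} (i : I) (x : (K.obj i).R n) :
    limH K n (toLim K i n x) = toLim K i (n + 1) ((K.obj i).h n x) := rfl

theorem iterH_limH_toLim {n : ℕ} (k : ℕ) (i : I) (x : (K.obj i).R n) :
    iterH (limH K) n k (toLim K i n x) = toLim K i (n + k) (iterH (K.obj i).h n k x) := by
  induction k with
  | zero => rfl
  | succ k ih => exact congrArg (limH K (n + k)) ih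

/-- The distinguished elements of the direct limit. -/
noncomputable def limTop (n : ℕ) : Lim K n :=
  toLim K (Classical.arbitrary I) n ((K.obj _).top n)

theorem limTop_eq (n : ℕ) (i : I) : limTop K n = toLim K i n ((K.obj i).top n) := by
  obtain ⟨j, hj, hij⟩ := exists_ge_ge (Classical.arbitrary I) i
  rw [limTop, ← toLim_trans n hj, ← toLim_trans n hij]
  exact congrArg _ (((K.map (homOfLE hj)).map_top n).trans
    ((K.map (homOfLE hij)).map_top n).symm)

/-- The direct limit of a directed diagram of Igr's. -/
noncomputable def directLimit : Igr.{u} where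
  R := Lim K
  top := limTop K
  h := limH K
  mul := limMul K
  zero_ne_top := by
    intro h
    rw [limTop, ← map_zero (toLim K (Classical.arbitrary I) 0), toLim_eq_iff] at h
    obtain ⟨j, hj, h⟩ := h
    rw [map_zero] at h
    exact (K.obj j).zero_ne_top (h.trans ((K.map (homOfLE hj)).map_top 0))
  eq_zero_or_top x := by
    obtain ⟨i, x, rfl⟩ := exists_toLim x
    obtain rfl | rfl := (K.obj i).eq_zero_or_top x
    · exact .inl (map_zero _)
    · exact .inr (limTop_eq K 0 i).symm
  add_self n x := by
    obtain ⟨i, x, rfl⟩ := exists_toLim x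
    rw [← map_add, (K.obj i).add_self, map_zero]
  h_top n := by
    rw [limTop, limH_toLim, (K.obj _).h_top]
    rfl
  h_eq n hn x := by
    obtain ⟨i, x, rfl⟩ := exists_toLim x
    rw [limTop_eq K 1 i, limH_toLim, limMul_toLim]
    exact mk_toLim ((K.obj i).h_eq n hn x)
  mul_assoc n m p x y z := by
    obtain ⟨i, x, y, z, rfl, rfl, rfl⟩ := exists_toLim₃ x y z
    simp only [limMul_toLim]
    exact mk_toLim ((K.obj i).mul_assoc n m p x y z)
  mul_comm n m x y := by
    obtain ⟨i, x, y, rfl, rfl⟩ := exists_toLim₂ x y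
    simp only [limMul_toLim]
    exact mk_toLim ((K.obj i).mul_comm n m x y)
  one_mul n x := by
    obtain ⟨i, x, rfl⟩ := exists_toLim x
    rw [limTop_eq K 0 i, limMul_toLim]
    exact mk_toLim ((K.obj i).one_mul n x)
  h_mul n m k l x y := by
    obtain ⟨i, x, y, rfl, rfl⟩ := exists_toLim₂ x y
    simp only [limMul_toLim, iterH_limH_toLim]
    exact mk_toLim ((K.obj i).h_mul n m k l x y)

/-- The cocone over a directed diagram of Igr's with vertex its direct limit. -/
noncomputable def directLimitCocone : Cocone K where
  pt := directLimit K
  ι :=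
    { app := fun i =>
        { app := toLim K i
          map_top := fun n => (limTop_eq K n i).symm
          map_mul := fun _ _ x y => (limMul_toLim K i x y).symm }
      naturality := fun i j hij => by
        refine Igr.Hom.ext ?_
        funext n
        ext x
        exact toLim_trans n (leOfHom hij) x }

/-- The natural map from a stage to the direct limit is a morphism of Igr's. -/
noncomputable abbrev toDirectLimit (i : I) : K.obj i ⟶ directLimit K := (directLimitCocone K).ι.app i

theorem toDirectLimit_map {i j : I} (hij : i ≤ j) (n : ℕ) (x : (K.obj i).R n) :
    (toDirectLimit K j).app n ((K.map (homOfLE hij)).app n x) = (toDirectLimit K i).app n x :=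
  toLim_trans n hij x

/-- Both conditions concern one element at a time, and that element lives at a stage. This makes the
direct limit the vertex of a cocone inside `Igr₊`. -/
theorem directLimit_plus (hK : ∀ i, plus (K.obj i)) : plus (directLimit K) := by
  constructor
  · intro n x
    obtain ⟨i, x, rfl⟩ := exists_toLim x
    have hx := AddSubgroup.mem_map_of_mem ((toDirectLimit K i).app (n + 1)) ((hK i).1 n x)
    rw [AddMonoidHom.map_closure] at hx
    refine AddSubgroup.closure_mono ?_ hx
    rintro _ ⟨_, ⟨a, rfl⟩, rfl⟩
    exact ⟨_, ((toDirectLimit K i).map_prodOne n a).symm⟩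
  · intro a
    obtain ⟨i, a, rfl⟩ := exists_toLim a
    have h := congrArg ((toDirectLimit K i).app (1 + 1)) ((hK i).2 a)
    rw [(toDirectLimit K i).map_mul, map_add, (toDirectLimit K i).map_top, map_zero] at h
    exact h

/-! ### Positive primitive formulas in a direct limit -/

/-- Finitely many elements of the direct limit come from a common stage. -/
theorem exists_toLim_finite {m : ℕ} {τ : Fin m → ℕ} (w : ∀ k, Lim K (τ k)) (i : I) :
    ∃ j, i ≤ j ∧ ∃ w' : ∀ k, (K.obj j).R (τ k), ∀ k, toLim K j (τ k) (w' k) = w k := by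
  choose d hd y hy using fun k => exists_toLim_ge (w k) i
  obtain ⟨j, hj⟩ := Finite.exists_le d
  obtain ⟨j', hj', hij⟩ := exists_ge_ge j i
  exact ⟨j', hij, fun k => trans K _ _ j' ((hj k).trans hj') (y k),
    fun k => (toLim_trans _ _ _).trans (hy k)⟩

/-- Finitely many atomic formulas that hold in the direct limit hold at a late stage. -/
theorem exists_holds_of_directLimit {V : Type} {sort : V → ℕ} (E : List (Atomic sort)) (i : I)
    (v : ∀ x, (K.obj i).R (sort x))
    (h : ∀ e ∈ E, e.Holds (directLimit K) (fun x => (toDirectLimit K i).app _ (v x))) :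
    ∃ j, ∃ hij : i ≤ j, ∀ e ∈ E, e.Holds (K.obj j) (fun x => (K.map (homOfLE hij)).app _ (v x)) := by
  -- The stage varies: each equation is settled by moving further along, and equations already true
  -- persist under transition maps.
  induction E generalizing i with
  | nil => exact ⟨i, le_rfl, by simp⟩
  | cons e E ih =>
    have he : toLim K i e.deg (e.lhs.eval (K.obj i) v) =
        toLim K i e.deg (e.rhs.eval (K.obj i) v) :=
      ((toDirectLimit K i).map_eval v e.lhs).trans ((h e List.mem_cons_self).trans
        ((toDirectLimit K i).map_eval v e.rhs).symm)
    obtain ⟨j, hij, hj⟩ := toLim_eq_iff.1 he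
    have hej : e.Holds (K.obj j) (fun x => (K.map (homOfLE hij)).app _ (v x)) :=
      ((K.map (homOfLE hij)).map_eval v e.lhs).symm.trans
        (hj.trans ((K.map (homOfLE hij)).map_eval v e.rhs))
    obtain ⟨k, hjk, hk⟩ := ih j (fun x => (K.map (homOfLE hij)).app _ (v x)) fun e' he' => by
      simpa only [toDirectLimit_map] using h e' (List.mem_cons_of_mem _ he')
    have hcomp : (fun x => (K.map (homOfLE (hij.trans hjk))).app (sort x) (v x)) =
        fun x => (K.map (homOfLE hjk)).app _ ((K.map (homOfLE hij)).app _ (v x)) :=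
      funext fun x => (trans_trans K _ hij hjk (v x)).symm
    refine ⟨k, hij.trans hjk, fun e' he' => ?_⟩
    rw [hcomp]
    obtain rfl | he' := List.mem_cons.1 he'
    · exact hej.map (K.map (homOfLE hjk))
    · exact hk e' he'

/-- A positive primitive formula that holds in the direct limit holds at a late stage. -/
theorem exists_solvable_of_directLimit {n m : ℕ} {σ : Fin n → ℕ} {τ : Fin m → ℕ}
    (E : List (Atomic (Sum.elim σ τ))) (i : I) (v : ∀ k, (K.obj i).R (σ k))
    (h : (directLimit K).Solvable E (fun k => (toDirectLimit K i).app _ (v k))) :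
    ∃ j, ∃ hij : i ≤ j, (K.obj j).Solvable E (fun k => (K.map (homOfLE hij)).app _ (v k)) := by
  obtain ⟨w, hw⟩ := h
  obtain ⟨j, hij, w', hw'⟩ := exists_toLim_finite K w i
  obtain rfl : (fun k => (toDirectLimit K j).app _ (w' k)) = w := funext hw'
  -- With the witnesses lifted to stage `j`, only equations between elements of that stage remain.
  obtain ⟨k, hjk, hk⟩ := exists_holds_of_directLimit K E j
    ((K.obj j).assign (fun k => (K.map (homOfLE hij)).app _ (v k)) w') fun e he => by
      rw [(toDirectLimit K j).map_assign]
      simpa only [toDirectLimit_map] using hw e he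
  refine ⟨k, hij.trans hjk, fun l => (K.map (homOfLE hjk)).app _ (w' l), fun e he => ?_⟩
  have := hk e he
  rw [(K.map (homOfLE hjk)).map_assign] at this
  have hcomp : (fun x => (K.map (homOfLE (hij.trans hjk))).app (σ x) (v x)) =
      fun x => (K.map (homOfLE hjk)).app _ ((K.map (homOfLE hij)).app _ (v x)) :=
    funext fun x => (trans_trans K _ hij hjk (v x)).symm
  rw [hcomp]
  exact this

end DirectLimit

end Igr

namespace Igr

/-! ### Consequences of purity -/

/-- Purity applied to the equation `x = y`, with no quantified variables. -/
theorem IsPure.injective {R S : Igr.{u}} {f : R ⟶ S} (hf : IsPure f) (n : ℕ) :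
    Function.Injective (f.app n) := by
  intro x y hxy
  obtain ⟨w, hw⟩ := hf 2 0 (fun _ => n) Fin.elim0
    [⟨n, Term.var (Sum.inl 0), Term.var (Sum.inl 1)⟩] ![x, y]
    ⟨fun k => k.elim0, by simpa [Atomic.Holds, Term.eval, assign] using hxy⟩
  simpa [Atomic.Holds, Term.eval, assign] using hw

theorem MC.of_injective {R S : Igr.{u}} (f : R ⟶ S) (hf : ∀ n, Function.Injective (f.app n))
    (hS : S.MC) : R.MC := by
  intro n k x hx
  refine hf n ((hS n k _ ?_).trans (map_zero _).symm)
  rw [← f.map_iterH, hx, map_zero]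

/-- The term `s` is chosen before `R`, so that one translated formula serves both the source and the
target of a morphism. -/
theorem exists_term_eval_eq_realize (d : ℕ) {n m : ℕ}
    (t : pointedLang.Term ((Fin n ⊕ Fin m) ⊕ Fin 0)) :
    ∃ s : Term (Sum.elim (fun _ : Fin n => d) (fun _ : Fin m => d)) d,
      ∀ (R : Igr.{u}) (v : Fin n → R.R d) (w : Fin m → R.R d) (xs : Fin 0 → R.R d),
        s.eval R (R.assign v w) = t.realize (Sum.elim (Sum.elim v w) xs) := by
  induction t with
  | var x =>
    rcases x with (k | k) | k
    · exact ⟨Term.var (Sum.inl k), fun _ _ _ _ => rfl⟩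
    · exact ⟨Term.var (Sum.inr k), fun _ _ _ _ => rfl⟩
    · exact k.elim0
  | @func l f ts ih =>
    choose s hs using ih
    change PointedFunc l at f
    cases f with
    | zero => exact ⟨.zero d, fun _ _ _ _ => rfl⟩
    | top => exact ⟨.top d, fun _ _ _ _ => rfl⟩
    | add => exact ⟨.add (s 0) (s 1), fun R v w xs => congrArg₂ _ (hs 0 R v w xs) (hs 1 R v w xs)⟩

/-- Atomic formulas about pointed modules translate to atomic formulas about Igr's. -/
theorem exists_atomic_holds_iff_realize (d : ℕ) {n m : ℕ}
    {φ : pointedLang.Formula (Fin n ⊕ Fin m)} (hφ : φ.IsAtomic) :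
    ∃ e : Atomic (Sum.elim (fun _ : Fin n => d) (fun _ : Fin m => d)),
      ∀ (R : Igr.{u}) (v : Fin n → R.R d) (w : Fin m → R.R d),
        e.Holds R (R.assign v w) ↔ φ.Realize (Sum.elim v w) := by
  cases hφ with
  | equal t₁ t₂ =>
    obtain ⟨s₁, h₁⟩ := exists_term_eval_eq_realize.{u} d t₁
    obtain ⟨s₂, h₂⟩ := exists_term_eval_eq_realize.{u} d t₂
    refine ⟨⟨d, s₁, s₂⟩, fun R v w => ?_⟩
    rw [Atomic.Holds, h₁ R v w default, h₂ R v w default]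
    exact (FirstOrder.Language.BoundedFormula.realize_bdEqual t₁ t₂).symm
  | rel r ts => exact r.elim

theorem IsPure.isPureHom_pointedHom {R S : Igr.{u}} {f : R ⟶ S} (hf : IsPure f) (d : ℕ) :
    IsPureHom (pointedHom f d) := by
  intro n m Φ hΦ v ⟨w, hw⟩
  choose e he using fun φ : {φ // φ ∈ Φ} => exists_atomic_holds_iff_realize.{u} d (hΦ φ.1 φ.2)
  obtain ⟨w', hw'⟩ := hf n m (fun _ => d) (fun _ => d) (Φ.attach.map e) v ⟨w, by
    simp only [List.mem_map, List.mem_attach, true_and]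
    rintro _ ⟨φ, rfl⟩
    exact (he φ S _ w).2 (hw φ.1 φ.2)⟩
  exact ⟨w', fun φ hφ => (he ⟨φ, hφ⟩ R v w').1
    (hw' _ (List.mem_map_of_mem (List.mem_attach _ ⟨φ, hφ⟩)))⟩

end Igr

/-! ### Functors preserving directed colimits -/

/-- If `M → M'` is a factor of the diagonal of a reduced power of `M`, then its image under a
functor that preserves directed colimits is pure. -/
theorem isPure_map_of_reducedPower {L : FirstOrder.Language.{u, u}}
    {A : ObjectProperty (StrCat L)}
    (F : A.FullSubcategory ⥤ Igr.plus.{u}.FullSubcategory)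
    {M M' : A.FullSubcategory} (j : M ⟶ M') (I : Type u) [PartialOrder I] [OrderBot I]
    [IsDirectedOrder I] [PreservesColimitsOfShape I F]
    (hT : ∀ d : I, A ((M.obj.tailPower I).obj d)) (hR : A (M.obj.reducedPower I))
    (g : M'.obj ⟶ M.obj.reducedPower I)
    (hg : j.hom ≫ g = M.obj.diag (Set.Ici (⊥ : I)) ≫ M.obj.tailPowerι I ⊥) :
    Igr.IsPure (F.map j).hom := by
  let G : I ⥤ A.FullSubcategory := A.lift (M.obj.tailPower I) hT
  let c : Cocone G :=
    { pt := ⟨_, hR⟩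
      ι :=
        { app := fun d => ObjectProperty.homMk (M.obj.tailPowerι I d)
          naturality := fun d e h =>
            ObjectProperty.hom_ext _ ((M.obj.reducedPowerCocone I).ι.naturality h) } }
  -- A full subcategory inclusion reflects colimits.
  have hc : IsColimit c := isColimitOfReflects A.ι (M.obj.reducedPowerIsColimit I)
  have hFc : IsColimit (F.mapCocone c) := isColimitOfPreserves F hc
  let K : I ⥤ Igr.{u} := (G ⋙ F) ⋙ Igr.plus.ι
  -- Only a comparison map from the colimit `F.mapCocone c` to the direct limit is needed, so a
  -- cocone suffices.
  let t : Cocone (G ⋙ F) :=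
    { pt := ⟨Igr.directLimit K, Igr.directLimit_plus K fun d => ((G ⋙ F).obj d).property⟩
      ι :=
        { app := fun d => ObjectProperty.homMk (Igr.toDirectLimit K d)
          naturality := fun d e h =>
            ObjectProperty.hom_ext _ ((Igr.directLimitCocone K).ι.naturality h) } }
  let δ : ∀ d : I, M ⟶ G.obj d := fun d => ObjectProperty.homMk (M.obj.diag (Set.Ici d))
  let π : ∀ d : I, G.obj d ⟶ M := fun d =>
    ObjectProperty.homMk (M.obj.proj (⟨d, le_refl d⟩ : Set.Ici d))
  -- The projections `π d` need not be compatible with each other: one stage `d` is used at the end.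
  have hδ : ∀ (d : I) (h : ⊥ ⟶ d), δ ⊥ ≫ G.map h ≫ π d = 𝟙 M := fun d h => rfl
  have hj : j ≫ (ObjectProperty.homMk g : M' ⟶ c.pt) = δ ⊥ ≫ c.ι.app ⊥ :=
    ObjectProperty.hom_ext _ hg
  have hFj : F.map j ≫ F.map (ObjectProperty.homMk g : M' ⟶ c.pt) ≫ hFc.desc t =
      F.map (δ ⊥) ≫ t.ι.app ⊥ := by
    rw [← Category.assoc, ← F.map_comp, hj, F.map_comp, Category.assoc]
    exact congrArg _ (hFc.fac t ⊥)
  intro n m σ τ E v hS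
  have h₁ := Igr.Solvable.map (F.map (ObjectProperty.homMk g : M' ⟶ c.pt) ≫ hFc.desc t).hom hS
  have h₂ : (Igr.directLimit K).Solvable E (fun k => (Igr.toDirectLimit K ⊥).app _
      ((F.map (δ ⊥)).hom.app _ (v k))) := by
    have e : ∀ k, (F.map (ObjectProperty.homMk g : M' ⟶ c.pt) ≫ hFc.desc t).hom.app (σ k)
        ((F.map j).hom.app (σ k) (v k)) = (Igr.toDirectLimit K ⊥).app _
        ((F.map (δ ⊥)).hom.app _ (v k)) := fun k =>
      congrArg (fun f : F.obj M ⟶ t.pt => f.hom.app (σ k) (v k)) hFj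
    simp only [e] at h₁
    exact h₁
  obtain ⟨d, hd, h₃⟩ := Igr.exists_solvable_of_directLimit K E ⊥ _ h₂
  -- Projecting to the coordinate `d` carries the solution into `F M` and the parameters back to
  -- `v`.
  have h₄ := h₃.map (F.map (π d)).hom
  have hid : F.map (δ ⊥) ≫ F.map (G.map (homOfLE hd)) ≫ F.map (π d) = 𝟙 (F.obj M) := by
    rw [← F.map_comp, ← F.map_comp, hδ, F.map_id]
  have e : ∀ k, (F.map (π d)).hom.app (σ k) ((K.map (homOfLE hd)).app (σ k)
      ((F.map (δ ⊥)).hom.app (σ k) (v k))) = v k := fun k =>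
    congrArg (fun f : F.obj M ⟶ F.obj M => f.hom.app (σ k) (v k)) hid
  simp only [e] at h₄
  exact h₄

theorem mainTheorem10 (L : FirstOrder.Language.{u, u}) (A : ObjectProperty (StrCat L))
    (hcolim : ClosedUnderDirectedColimits A) (hpow : ClosedUnderPowers A)
    (F : A.FullSubcategory ⥤ Igr.plus.{u}.FullSubcategory)
    (hF : PreservesDirectedColimits F)
    (M M' : A.FullSubcategory) (j : M ⟶ M') (hj : StrCat.IsPure j.hom) :
    Igr.IsPure (F.map j).hom ∧
    (∀ n : ℕ, IsPureHom (Igr.pointedHom (F.map j).hom n)) ∧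
    (∀ n : ℕ, Function.Injective ((F.map j).hom.app n)) ∧
    ((F.obj M').obj.MC → (F.obj M).obj.MC) := by
  have hpure : Igr.IsPure (F.map j).hom := by
    obtain ⟨I, _, _, _, g, hg⟩ := hj.exists_reducedPower
    have := hcolim I
    have := hF I
    have hT : ∀ d : I, A ((M.obj.tailPower I).obj d) := fun d =>
      -- Closure under powers is assumed only for non-empty exponents.
      haveI : Nonempty (Set.Ici d) := ⟨⟨d, le_rfl⟩⟩
      hpow _ _ M.property
    exact isPure_map_of_reducedPower F j I hT
      (A.prop_of_isColimit (M.obj.reducedPowerIsColimit I) hT) g hg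
  exact ⟨hpure, hpure.isPureHom_pointedHom, hpure.injective,
    Igr.MC.of_injective _ hpure.injective⟩
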